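/- Let $(a(m))_{m\ge 0}$ be Stern's diatomic sequence, defined by $a(0)=0$, $a(1)=1$, $a(2m)=a(m)$ and $a(2m+1)=a(m)+a(m+1)$ for $m\ge 0$. A record-setter of it is an index $v$ such that $a(i)<a(v)$ for all $0\le i<v$. Let $F_m$ be the Fibonacci numbers ($F_0=0$, $F_1=1$, $F_m=F_{m-1}+F_{m-2}$ for $m \ge 2$) and $L_m$ the Lucas numbers ($L_0=2$, $L_1=1$, $L_m=L_{m-1}+L_{m-2}$ for $m \ge 2$). Let $k\ge 12$. (i) If $k=2n$ is even, then the record-setters lying in $[2^{k-1},2^k)$ are, in increasing order (the families one after the other, each listed by increasing parameter), - $2^{2n-1}+\dfrac{2^{2n-2}-2^{2n-2a-3}+1}{3}$ for $0\le a\le n-3$; - $\dfrac{2^{2n+1}-2^{2n-2b}-1}{3}$ for $1\le b\le\lfloor n/2\rfloor$; - $\dfrac{2^{2n+1}+1}{3}$. Their Stern values are, respectively, - $L_{2a+3}F_{2n-2a-3}+L_{2a+1}F_{2n-2a-4}$; - $F_{2b+2}F_{2n-2b}+F_{2b}F_{2n-2b-1}$; - $F_{2n+1}$. (ii) If $k=2n+1$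 is odd, then the record-setters lying in $[2^{k-1},2^k)$ are, in increasing order (the families one after the other, each listed by increasing parameter), - $2^{2n}+\dfrac{2^{2n-2}-1}{3}$; - $2^{2n}+2^{2n-3}+\dfrac{2^{2n-4}-7}{3}$; - $2^{2n}+\dfrac{2^{2n-1}-2^{2n-2b-2}-1}{3}$ for $1\le b\le\lceil n/2\rceil-1$; - $\dfrac{2^{2n+2}-2^{2n-2a-1}+1}{3}$ for $0\le a\le n-2$; - $\dfrac{2^{2n+2}-1}{3}$. Their Stern values are, respectively, - $F_{2n+1}+F_{2n-4}$; - $F_{2n+1}+8F_{2n-8}$; - $L_{2b+3}F_{2n-2b-2}+L_{2b+1}F_{2n-2b-3}$; - $F_{2a+4}F_{2n-2a-1}+F_{2a+2}F_{2n-2a-2}$; - $F_{2n+2}$. -/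

import Mathlib

/-- Stern's diatomic sequence: `a(0) = 0`, `a(1) = 1`, `a(2n) = a(n)`,
`a(2n+1) = a(n) + a(n+1)`. -/
def stern (m : ℕ) : ℕ :=
  if m ≤ 1 then m
  else if m % 2 = 0 then stern (m / 2)
  else stern (m / 2) + stern (m / 2 + 1)
termination_by m
decreasing_by all_goals omega

theorem stern_zero : stern 0 = 0 := by
  rw [stern]; simp

theorem stern_one : stern 1 = 1 := by
  rw [stern]; simp

theorem stern_two_mul (n : ℕ) : stern (2 * n) = stern n := by
  rcases Nat.eq_zero_or_pos n with rfl | hn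
  · rfl
  · rw [stern, if_neg (by omega), if_pos (by omega), show 2 * n / 2 = n by omega]

theorem stern_two_mul_add_one (n : ℕ) :
    stern (2 * n + 1) = stern n + stern (n + 1) := by
  rcases Nat.eq_zero_or_pos n with rfl | hn
  · simp [stern_zero]
  · rw [stern, if_neg (by omega), if_neg (by omega), show (2 * n + 1) / 2 = n by omega]

/-- The Lucas numbers `2, 1, 3, 4, 7, 11, …`. -/
def lucas : ℕ → ℕ
  | 0 => 2
  | 1 => 1
  | n + 2 => lucas (n + 1) + lucas n

/-- `v` is a record-setter of the sequence `s` if `s i < s v` for all `i < v`. -/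
def IsRecordSetter (s : ℕ → ℕ) (v : ℕ) : Prop :=
  ∀ i, i < v → s i < s v

instance (s : ℕ → ℕ) : DecidablePred (IsRecordSetter s) := fun v =>
  inferInstanceAs (Decidable (∀ i, i < v → s i < s v))

/-- The record-setters of the Stern sequence in `[2 ^ (k - 1), 2 ^ k)`, listed in increasing
order. -/
def sternRecordSetters (k : ℕ) : List ℕ :=
  ((Finset.Ico (2 ^ (k - 1)) (2 ^ k)).filter (IsRecordSetter stern)).sort (· ≤ ·)

/-! Write s for `stern`. Appending binary digits to m acts linearly on the pair (s(m), s(m+1)), and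
s is at most F_{l+1} up to 2^l. Suppose i < v agrees with v up to a prefix q, then has 0 where v has
1, and l digits follow. Then s(i) ≤ F_{l+2} s(q) + F_{l+1} s(q+1), by
`stern_two_pow_mul_two_mul_add_le`. Bounding s below v therefore costs at most one inequality for
each digit 1 of v, and `SternLE` collects these along the digits.

The record-setters consist of runs of blocks 10 with a few defects. A run acts by a power of a
Fibonacci matrix (`stern_block`), so all values are bilinear in Fibonacci numbers. A deviation in
the first run has as its bound the value of a member of the same or a neighbouring family
(`extE_block_four` and its companions). A deviation in the second run is compared directly with the
previous record (`extO_block_two_mul_block_four_le` and its companions).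

Within a family, the defect moves through the run. By a d'Ocagne type identity, the difference of
neighbouring values depends only on the difference of the two run lengths. It is always positive for
`evenLow` and `oddHigh`; for `evenHigh` and `oddLow` the growth stops at the middle, which produces
the ranges ending at ⌊n/2⌋ and ⌈n/2⌉ - 1. The isolated `oddSporadic` is the one deviation below
`oddLow 1` that beats `oddLow 0`.

The relations `IsNextRecord` link these numbers into a chain. It starts at the last record of the
preceding dyadic interval and ends at a number attaining the Fibonacci maximum, so nothing can be
missing. -/

/-! ### Fibonacci numbers with odd and even index -/

/-- The Fibonacci number with index `2 * j - 1`. -/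
def fibO : ℕ → ℕ
  | 0 => 1
  | j + 1 => Nat.fib (2 * j + 1)

/-- The Fibonacci number with index `2 * j`. -/
def fibE (j : ℕ) : ℕ := Nat.fib (2 * j)

theorem fib_two_mul_add_one_eq (j : ℕ) : Nat.fib (2 * j + 1) = fibO j + fibE j := by
  cases j with
  | zero => rfl
  | succ j =>
    rw [fibO, fibE, show 2 * (j + 1) + 1 = 2 * j + 1 + 2 by ring, Nat.fib_add_two]
    rfl

theorem fibO_zero : fibO 0 = 1 := rfl

theorem fibE_zero : fibE 0 = 0 := rfl

theorem fibO_succ (j : ℕ) : fibO (j + 1) = fibO j + fibE j := by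
  rw [← fib_two_mul_add_one_eq, fibO]

theorem fibE_succ (j : ℕ) : fibE (j + 1) = fibO j + 2 * fibE j := by
  rw [fibE, show 2 * (j + 1) = 2 * j + 2 by ring, Nat.fib_add_two, fib_two_mul_add_one_eq, fibE]
  ring

theorem fibO_pos (j : ℕ) : 0 < fibO j := by
  cases j with
  | zero => exact one_pos
  | succ j => exact Nat.fib_pos.2 (by omega)

/-- These are entries of M^(i+j) = M^i M^j, where M has rows (1, 1), (1, 2) and M^j has rows (`fibO
j`, `fibE j`), (`fibE j`, `fibO j + fibE j`). -/
theorem fibO_add (i j : ℕ) : fibO (i + j) = fibO i * fibO j + fibE i * fibE j ∧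
    fibE (i + j) = fibO i * fibE j + fibE i * fibO j + fibE i * fibE j := by
  induction j with
  | zero => simp [fibO_zero, fibE_zero]
  | succ j ih =>
    rw [← add_assoc, fibO_succ, fibE_succ, fibO_succ, fibE_succ]
    exact ⟨by linear_combination ih.1 + ih.2, by linear_combination ih.1 + 2 * ih.2⟩

theorem fibE_add (i j : ℕ) :
    fibE (i + j) = fibO i * fibE j + fibE i * fibO j + fibE i * fibE j :=
  (fibO_add i j).2

theorem fib_two_mul_eq (j : ℕ) : Nat.fib (2 * j) = fibE j := rfl

theorem lucas_succ (m : ℕ) : lucas (m + 1) = Nat.fib m + Nat.fib (m + 2) := by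
  induction m using Nat.twoStepInduction with
  | zero => rfl
  | one => rfl
  | more m h₁ h₂ =>
    rw [lucas, h₁, h₂, Nat.fib_add_two (n := m + 2), Nat.fib_add_two (n := m + 1),
      Nat.fib_add_two (n := m)]
    ring

theorem lucas_two_mul_add_one (j : ℕ) : lucas (2 * j + 1) = fibO j + 3 * fibE j := by
  rw [lucas_succ, Nat.fib_add_two, fib_two_mul_add_one_eq, fib_two_mul_eq]
  ring

theorem lucas_two_mul_add_three (j : ℕ) : lucas (2 * j + 3) = 4 * fibO j + 7 * fibE j := by
  rw [show 2 * j + 3 = 2 * (j + 1) + 1 by ring, lucas_two_mul_add_one, fibO_succ, fibE_succ]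
  ring

/-! ### Upper bounds for the Stern sequence on initial segments -/

theorem stern_two_pow_mul_add (l m r : ℕ) (hr : r ≤ 2 ^ l) :
    stern (2 ^ l * m + r) = stern (2 ^ l - r) * stern m + stern r * stern (m + 1) := by
  induction l generalizing r with
  | zero =>
    obtain rfl | rfl : r = 0 ∨ r = 1 := by simp at hr; omega
    · simp [stern_zero, stern_one]
    · simp [stern_zero, stern_one]
  | succ l ih =>
    rw [pow_succ] at hr ⊢
    obtain ⟨s, rfl | rfl⟩ : ∃ s, r = 2 * s ∨ r = 2 * s + 1 := ⟨r / 2, by omega⟩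
    · rw [show 2 ^ l * 2 * m + 2 * s = 2 * (2 ^ l * m + s) by ring,
        show 2 ^ l * 2 - 2 * s = 2 * (2 ^ l - s) by omega, stern_two_mul, stern_two_mul,
        stern_two_mul, ih s (by omega)]
    · rw [show 2 ^ l * 2 * m + (2 * s + 1) = 2 * (2 ^ l * m + s) + 1 by ring,
        show 2 ^ l * 2 - (2 * s + 1) = 2 * (2 ^ l - (s + 1)) + 1 by omega, stern_two_mul_add_one,
        stern_two_mul_add_one, stern_two_mul_add_one, add_assoc, ih s (by omega),
        ih (s + 1) (by omega), show 2 ^ l - (s + 1) + 1 = 2 ^ l - s by omega]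
      ring

/-- Of two consecutive arguments one is even, and halving it gains a level; this yields the
Fibonacci recursion. -/
theorem stern_le_fib (l r : ℕ) (hr : r ≤ 2 ^ l) : stern r ≤ Nat.fib (l + 1) := by
  induction l using Nat.twoStepInduction generalizing r with
  | zero =>
    obtain rfl | rfl : r = 0 ∨ r = 1 := by simp at hr; omega
    · simp [stern_zero]
    · simp [stern_one]
  | one =>
    obtain rfl | rfl | rfl : r = 0 ∨ r = 1 ∨ r = 2 := by simp at hr; omega
    · simp [stern_zero]
    · simp [stern_one, Nat.fib]
    · rw [show 2 = 2 * 1 by rfl, stern_two_mul, stern_one]; exact le_rfl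
  | more l h₁ h₂ =>
    rw [pow_succ] at hr
    have hm : Nat.fib (l + 2) ≤ Nat.fib (l + 3) := Nat.fib_mono (by omega)
    obtain ⟨s, rfl | rfl⟩ : ∃ s, r = 2 * s ∨ r = 2 * s + 1 := ⟨r / 2, by omega⟩
    · rw [stern_two_mul]
      exact (h₂ s (by omega)).trans hm
    · rw [stern_two_mul_add_one, show l + 2 + 1 = l + 1 + 2 by ring, Nat.fib_add_two]
      rw [pow_succ] at hr
      obtain ⟨t, rfl | ht⟩ : ∃ t, s = 2 * t ∨ s + 1 = 2 * t := ⟨(s + 1) / 2, by omega⟩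
      · rw [stern_two_mul]
        exact add_le_add (h₁ t (by omega)) (h₂ (2 * t + 1) (by rw [pow_succ]; omega))
      · rw [add_comm, ht, stern_two_mul]
        exact add_le_add (h₁ t (by omega)) (h₂ s (by rw [pow_succ]; omega))

theorem stern_two_pow_add_le_fib (l r : ℕ) (hr : r ≤ 2 ^ l) :
    stern (2 ^ l + r) ≤ Nat.fib (l + 2) :=
  stern_le_fib (l + 1) _ (by rw [pow_succ]; omega)

theorem stern_add_one_two_pow_sub (l r : ℕ) (hr : r ≤ 2 ^ l) :
    stern (2 ^ l - r) + stern r = stern (2 ^ l + r) := by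
  have h := stern_two_pow_mul_add l 1 r hr
  have h2 : stern 2 = 1 := by rw [show 2 = 2 * 1 by rfl, stern_two_mul, stern_one]
  rw [mul_one, stern_one, mul_one, h2, mul_one] at h
  exact h.symm

/-- The digit 0 after q makes the coefficient of `stern q` equal to s(2^l - r) + s(r) = s(2^l + r),
which is one Fibonacci level higher than the coefficient of `stern (q + 1)`. -/
theorem stern_two_pow_mul_two_mul_add_le (l q r : ℕ) (hr : r ≤ 2 ^ l) :
    stern (2 ^ l * (2 * q) + r)
      ≤ Nat.fib (l + 2) * stern q + Nat.fib (l + 1) * stern (q + 1) := by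
  rw [stern_two_pow_mul_add l _ r hr, stern_two_mul, stern_two_mul_add_one, mul_add, ← add_assoc,
    ← add_mul, stern_add_one_two_pow_sub l r hr]
  exact add_le_add (Nat.mul_le_mul_right _ (stern_two_pow_add_le_fib l r hr))
    (Nat.mul_le_mul_right _ (stern_le_fib l r hr))

/-- All values of the Stern sequence before `2 ^ l * q` are at most `C`. -/
def SternLE (C q l : ℕ) : Prop :=
  ∀ i, i < 2 ^ l * q → stern i ≤ C

theorem SternLE.zero (C l : ℕ) : SternLE C 0 l := fun i hi => by simp at hi

theorem SternLE.two_mul {C q l : ℕ} (h : SternLE C q (l + 1)) : SternLE C (2 * q) l :=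
  fun i hi => h i (by rwa [pow_succ, mul_assoc])

/-- Appending 1 adds just those arguments that deviate at this digit: q, then 0, then l free digits.
Appending 0 adds none. -/
theorem SternLE.two_mul_add_one {C q l : ℕ} (h : SternLE C q (l + 1))
    (hC : Nat.fib (l + 2) * stern q + Nat.fib (l + 1) * stern (q + 1) ≤ C) :
    SternLE C (2 * q + 1) l := by
  intro i hi
  rcases lt_or_ge i (2 ^ l * (2 * q)) with h' | h'
  · exact h.two_mul i h'
  · obtain ⟨r, rfl⟩ := Nat.exists_eq_add_of_le h'
    refine (stern_two_pow_mul_two_mul_add_le l q r ?_).trans hC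
    rw [mul_add, mul_one] at hi
    omega

/-- A final 1 adds only the argument 2q, whose value already occurs at q, so no inequality is
needed. -/
theorem SternLE.last {C q : ℕ} (h : SternLE C q 1) : SternLE C (2 * q + 1) 0 := by
  intro i hi
  rcases eq_or_ne i (2 * q) with rfl | h'
  · rw [stern_two_mul]
    rcases Nat.eq_zero_or_pos q with rfl | hq
    · simp [stern_zero]
    · exact h q (by omega)
  · exact h i (by simp at hi; omega)

/-! ### Appending blocks `10` to a binary expansion -/

/-- The number obtained from `q` by appending `c` blocks `10` to its binary expansion. -/
def block (q : ℕ) : ℕ → ℕ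
  | 0 => q
  | c + 1 => 4 * block q c + 2

theorem block_zero (q : ℕ) : block q 0 = q := rfl

theorem block_succ (q c : ℕ) : block q (c + 1) = 4 * block q c + 2 := rfl

theorem block_add (q b c : ℕ) : block q (b + c) = block (block q b) c := by
  induction c with
  | zero => rfl
  | succ c ih => rw [← add_assoc, block_succ, ih, block_succ]

theorem block_succ' (q c : ℕ) : block q (c + 1) = block (4 * q + 2) c := by
  rw [add_comm, block_add]; rfl

theorem three_mul_block (q c : ℕ) : 3 * block q c + 2 = 4 ^ c * (3 * q + 2) := by
  induction c with
  | zero => simp [block_zero]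
  | succ c ih =>
    rw [block_succ, pow_succ]
    linarith

theorem block_cast (q c : ℕ) : (block q c : ℚ) = (4 ^ c * (3 * q + 2) - 2) / 3 := by
  have h : ((3 * block q c + 2 : ℕ) : ℚ) = ((4 ^ c * (3 * q + 2) : ℕ) : ℚ) := by
    rw [three_mul_block]
  push_cast at h
  linarith

theorem block_lt_block {p q : ℕ} (h : p < q) (c : ℕ) : block p c < block q c := by
  induction c with
  | zero => exact h
  | succ c ih => rw [block_succ, block_succ]; omega

/-- Each block 10 sends (x, y) to (x + y, x + 2y). -/
theorem stern_block (q c : ℕ) :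
    stern (block q c) = fibO c * stern q + fibE c * stern (q + 1) ∧
    stern (block q c + 1) = fibE c * stern q + (fibO c + fibE c) * stern (q + 1) := by
  induction c with
  | zero => simp [block_zero, fibO_zero, fibE_zero]
  | succ c ih =>
    rw [block_succ, show 4 * block q c + 2 = 2 * (2 * block q c + 1) by ring, stern_two_mul,
      stern_two_mul_add_one, stern_two_mul_add_one,
      show 2 * block q c + 1 + 1 = 2 * (block q c + 1) by ring, stern_two_mul,
        stern_two_mul_add_one,
      ih.1, ih.2, fibO_succ, fibE_succ]
    constructor <;> ring

theorem stern_block_add_one (q c : ℕ) :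
    stern (block q c + 1) = fibE c * stern q + (fibO c + fibE c) * stern (q + 1) :=
  (stern_block q c).2

theorem stern_two_mul_block_add_one (q c : ℕ) :
    stern (2 * block q c + 1)
      = (fibO c + fibE c) * stern q + (fibO c + 2 * fibE c) * stern (q + 1) := by
  rw [stern_two_mul_add_one, (stern_block q c).1, stern_block_add_one]
  ring

theorem stern_four_mul_block_add_three (q c : ℕ) :
    stern (4 * block q c + 3)
      = (fibO c + 2 * fibE c) * stern q + (2 * fibO c + 3 * fibE c) * stern (q + 1) := by
  rw [show 4 * block q c + 3 = 2 * (2 * block q c + 1) + 1 by ring, stern_two_mul_add_one,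
    stern_two_mul_block_add_one, show 2 * block q c + 1 + 1 = 2 * (block q c + 1) by ring,
      stern_two_mul,
    stern_block_add_one]
  ring

/-- In `hC` the deviation replaces the leading 1 of a block after j complete blocks. The free digits
are the 0 of that block, the r remaining blocks and the last l digits. -/
theorem sternLE_block {C q c l : ℕ} (h : SternLE C q (2 * c + l))
    (hC : ∀ j r, j + r + 1 = c → Nat.fib (2 * r + 1 + l + 2) * stern (block q j)
      + Nat.fib (2 * r + 1 + l + 1) * stern (block q j + 1) ≤ C) :
    SternLE C (block q c) l := by
  induction c generalizing l with
  | zero => simpa [block_zero] using h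
  | succ c ih =>
    rw [block_succ, show 4 * block q c + 2 = 2 * (2 * block q c + 1) by ring]
    refine SternLE.two_mul (SternLE.two_mul_add_one (ih ?_ fun j r hj => ?_) ?_)
    · rwa [show 2 * c + (l + 1 + 1) = 2 * (c + 1) + l by ring]
    · have := hC j (r + 1) (by omega)
      rwa [show 2 * (r + 1) + 1 + l = 2 * r + 1 + (l + 1 + 1) by ring] at this
    · have := hC c 0 rfl
      rwa [show 2 * 0 + 1 + l = l + 1 by ring] at this

/-- The largest value of the Stern sequence at a binary expansion that consists of the one of `q`,
of `0` and of `2 * r + 1` further digits, if `x` and `y` are the values at `q` and `q + 1`. -/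
def extO (x y r : ℕ) : ℕ := (2 * fibE r + fibO r + fibO r + fibE r) * x + (fibO r + 2 * fibE r) * y

/-- The largest value of the Stern sequence at a binary expansion that consists of the one of `q`,
of `0` and of `2 * r + 2` further digits, if `x` and `y` are the values at `q` and `q + 1`. -/
def extE (x y r : ℕ) : ℕ := (3 * fibO r + 5 * fibE r) * x + (2 * fibO r + 3 * fibE r) * y

theorem extO_eq (x y r : ℕ) :
    extO x y r = Nat.fib (2 * r + 3) * x + Nat.fib (2 * r + 2) * y := by
  rw [show 2 * r + 3 = 2 * (r + 1) + 1 by ring, show 2 * r + 2 = 2 * (r + 1) by ring,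
    fib_two_mul_add_one_eq, fib_two_mul_eq, fibO_succ, fibE_succ, extO]
  ring

theorem extE_eq (x y r : ℕ) :
    extE x y r = Nat.fib (2 * r + 4) * x + Nat.fib (2 * r + 3) * y := by
  rw [show 2 * r + 4 = 2 * (r + 1 + 1) by ring, show 2 * r + 3 = 2 * (r + 1) + 1 by ring,
    fib_two_mul_add_one_eq, fib_two_mul_eq, fibE_succ, fibO_succ, fibE_succ, extE]
  ring

theorem sternLE_block_even {C q c s : ℕ} (h : SternLE C q (2 * (c + s)))
    (hC : ∀ j r, j + r + 1 = c → extO (stern (block q j)) (stern (block q j + 1)) (r + s) ≤ C) :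
    SternLE C (block q c) (2 * s) := by
  refine sternLE_block (by rwa [← mul_add]) fun j r hj => ?_
  have := hC j r hj
  rw [extO_eq] at this
  convert this using 4 <;> ring

theorem sternLE_block_odd {C q c s : ℕ} (h : SternLE C q (2 * (c + s) + 1))
    (hC : ∀ j r, j + r + 1 = c → extE (stern (block q j)) (stern (block q j + 1)) (r + s) ≤ C) :
    SternLE C (block q c) (2 * s + 1) := by
  refine sternLE_block (by convert h using 1; ring) fun j r hj => ?_
  have := hC j r hj
  rw [extE_eq] at this
  convert this using 4 <;> ring

theorem sternLE_block_one {C q c : ℕ} (h : SternLE C q (2 * c + 1))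
    (hC : ∀ j r, j + r + 1 = c → extE (stern (block q j)) (stern (block q j + 1)) r ≤ C) :
    SternLE C (2 * block q c + 1) 0 := by
  exact SternLE.last (sternLE_block_odd (s := 0) h hC)

/-- Unlike in `sternLE_block_one`, the first of the two final digits 1 is a genuine place of
deviation. It contributes j = c, r = 0. -/
theorem sternLE_block_one_one {C q c : ℕ} (h : SternLE C q (2 * (c + 1)))
    (hC : ∀ j r, j + r = c → extO (stern (block q j)) (stern (block q j + 1)) r ≤ C) :
    SternLE C (4 * block q c + 3) 0 := by
  rw [show 4 * block q c + 3 = 2 * (2 * block q c + 1) + 1 by ring]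
  refine SternLE.last (SternLE.two_mul_add_one
    (sternLE_block_even (s := 1) h fun j r hj => hC j (r + 1) (by omega)) ?_)
  have := hC c 0 rfl
  rwa [extO_eq] at this

/-! ### The binary expansions of the record-setters -/

/-- The number with binary expansion `100(10)^a 0(10)^c 11`. -/
def evenLow (a c : ℕ) : ℕ := 4 * block (2 * block 4 a) c + 3

/-- The number with binary expansion `(10)^b 0(10)^c 1`. -/
def evenHigh (b c : ℕ) : ℕ := 2 * block (2 * block 0 b) c + 1

/-- The number with binary expansion `(10)^c 11`. -/
def evenLast (c : ℕ) : ℕ := 4 * block 0 c + 3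

/-- The number with binary expansion `100(10)^b 0(10)^c 1`. -/
def oddLow (b c : ℕ) : ℕ := 2 * block (2 * block 4 b) c + 1

/-- The number with binary expansion `100100(10)^c 011`. -/
def oddSporadic (c : ℕ) : ℕ := 8 * block 36 c + 3

/-- The number with binary expansion `(10)^(a + 1) 0(10)^c 11`. -/
def oddHigh (a c : ℕ) : ℕ := 4 * block (2 * block 0 (a + 1)) c + 3

/-- The number with binary expansion `(10)^c 1`. -/
def oddLast (c : ℕ) : ℕ := 2 * block 0 c + 1

theorem fibO_add_eq (i j : ℕ) : fibO (i + j) = fibO i * fibO j + fibE i * fibE j :=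
  (fibO_add i j).1

theorem stern_two : stern 2 = 1 := by rw [show 2 = 2 * 1 by rfl, stern_two_mul, stern_one]

theorem stern_four : stern 4 = 1 := by rw [show 4 = 2 * 2 by rfl, stern_two_mul, stern_two]

theorem stern_five : stern 5 = 3 := by
  rw [show 5 = 2 * 2 + 1 by rfl, stern_two_mul_add_one, stern_two, show 2 + 1 = 2 * 1 + 1 by rfl,
    stern_two_mul_add_one, stern_two, stern_one]

theorem stern_nine : stern 9 = 4 := by
  rw [show 9 = 2 * 4 + 1 by rfl, stern_two_mul_add_one, stern_four, stern_five]

theorem stern_block_zero (b : ℕ) :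
    stern (block 0 b) = fibE b ∧ stern (block 0 b + 1) = fibO b + fibE b := by
  rw [(stern_block 0 b).1, (stern_block 0 b).2, stern_zero, stern_one]
  simp

theorem stern_block_four (b : ℕ) :
    stern (block 4 b) = fibO b + 3 * fibE b ∧ stern (block 4 b + 1) = 3 * fibO b + 4 * fibE b := by
  rw [(stern_block 4 b).1, (stern_block 4 b).2, stern_four, stern_five]
  constructor <;> ring

theorem stern_two_mul_block_zero (b : ℕ) :
    stern (2 * block 0 b) = fibE b ∧ stern (2 * block 0 b + 1) = fibO b + 2 * fibE b := by
  rw [stern_two_mul, stern_two_mul_add_one, (stern_block_zero b).1, (stern_block_zero b).2]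
  constructor <;> ring

theorem stern_two_mul_block_four (b : ℕ) :
    stern (2 * block 4 b) = fibO b + 3 * fibE b ∧
      stern (2 * block 4 b + 1) = 4 * fibO b + 7 * fibE b := by
  rw [stern_two_mul, stern_two_mul_add_one, (stern_block_four b).1, (stern_block_four b).2]
  constructor <;> ring

theorem stern_block_thirtySix (c : ℕ) :
    stern (block 36 c) = 4 * fibO c + 11 * fibE c ∧
      stern (block 36 c + 1) = 11 * fibO c + 15 * fibE c := by
  have h18 : stern 18 = 4 := by rw [show 18 = 2 * 9 by rfl, stern_two_mul, stern_nine]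
  have h19 : stern 19 = 7 := by
    rw [show 19 = 2 * 9 + 1 by rfl, stern_two_mul_add_one, stern_nine, show 9 + 1 = 2 * 5 by rfl,
      stern_two_mul, stern_five]
  rw [(stern_block 36 c).1, (stern_block 36 c).2, show 36 = 2 * 18 by rfl, stern_two_mul,
    stern_two_mul_add_one, h18, h19]
  constructor <;> ring

theorem stern_block_eight (c : ℕ) :
    stern (block 8 c) = fibO c + 4 * fibE c ∧
      stern (block 8 c + 1) = 4 * fibO c + 5 * fibE c := by
  rw [(stern_block 8 c).1, (stern_block 8 c).2, show 8 = 2 * 4 by rfl, stern_two_mul,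
    show 2 * 4 + 1 = 9 by rfl, stern_nine, stern_four]
  constructor <;> ring

theorem stern_evenLow (a c : ℕ) : stern (evenLow a c) =
    (fibO c + 2 * fibE c) * (fibO a + 3 * fibE a)
      + (2 * fibO c + 3 * fibE c) * (4 * fibO a + 7 * fibE a) := by
  rw [evenLow, stern_four_mul_block_add_three, (stern_two_mul_block_four a).1,
    (stern_two_mul_block_four a).2]

theorem stern_evenHigh (b c : ℕ) : stern (evenHigh b c) =
    (fibO c + fibE c) * fibE b + (fibO c + 2 * fibE c) * (fibO b + 2 * fibE b) := by
  rw [evenHigh, stern_two_mul_block_add_one, (stern_two_mul_block_zero b).1,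
    (stern_two_mul_block_zero b).2]

theorem stern_evenLast (c : ℕ) : stern (evenLast c) = 2 * fibO c + 3 * fibE c := by
  rw [evenLast, stern_four_mul_block_add_three, stern_zero, stern_one]
  ring

theorem stern_oddLow (b c : ℕ) : stern (oddLow b c) =
    (fibO c + fibE c) * (fibO b + 3 * fibE b)
      + (fibO c + 2 * fibE c) * (4 * fibO b + 7 * fibE b) := by
  rw [oddLow, stern_two_mul_block_add_one, (stern_two_mul_block_four b).1,
    (stern_two_mul_block_four b).2]

theorem stern_oddSporadic (c : ℕ) : stern (oddSporadic c) = 34 * fibO c + 63 * fibE c := by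
  rw [oddSporadic, show 8 * block 36 c + 3 = 2 * (2 * (2 * block 36 c) + 1) + 1 by ring,
    stern_two_mul_add_one, stern_two_mul_add_one,
    show 2 * (2 * block 36 c) + 1 + 1 = 2 * (2 * block 36 c + 1) by ring, stern_two_mul,
    stern_two_mul, stern_two_mul_add_one, (stern_block_thirtySix c).1, (stern_block_thirtySix c).2]
  ring

theorem stern_oddHigh (a c : ℕ) : stern (oddHigh a c) =
    (fibO c + 2 * fibE c) * (fibO a + 2 * fibE a)
      + (2 * fibO c + 3 * fibE c) * (3 * fibO a + 5 * fibE a) := by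
  rw [oddHigh, stern_four_mul_block_add_three, (stern_two_mul_block_zero _).1,
    (stern_two_mul_block_zero _).2, fibO_succ, fibE_succ]
  ring

theorem stern_oddLast (c : ℕ) : stern (oddLast c) = fibO c + 2 * fibE c := by
  rw [oddLast, stern_two_mul_block_add_one, stern_zero, stern_one]
  ring

/-! ### Comparison of the values along a family -/

theorem fibE_lt_three_mul_fibO (j : ℕ) : fibE j < 3 * fibO j := by
  cases j with
  | zero => simp [fibO_zero, fibE_zero]
  | succ j =>
    have := fibO_pos j
    rw [fibO_succ, fibE_succ]
    omega

/-- The difference of the two values is the difference of the sides of `key`. That form is unchanged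
under (a, c) ↦ (a + 1, c + 1), so the induction descends to the case where one index vanishes. -/
theorem stern_evenLow_lt (a c : ℕ) :
    stern (evenLow a (c + 1)) < stern (evenLow (a + 1) c) := by
  have key : fibE a * fibO c + 3 * (fibE a * fibE c)
      < 3 * (fibO a * fibO c) + 4 * (fibO a * fibE c) := by
    induction a generalizing c with
    | zero =>
      have := fibO_pos c
      simp only [fibO_zero, fibE_zero]
      omega
    | succ a ih =>
      cases c with
      | zero =>
        have := fibE_lt_three_mul_fibO (a + 1)
        simp only [fibO_zero, fibE_zero]
        omega
      | succ c =>
        have := ih c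
        simp only [fibO_succ, fibE_succ]
        linarith
  simp only [stern_evenLow, fibO_succ, fibE_succ]
  linarith

theorem stern_oddHigh_lt (a c : ℕ) :
    stern (oddHigh a (c + 1)) < stern (oddHigh (a + 1) c) := by
  have key : fibE a * fibE c < fibO a * fibO c + fibO a * fibE c := by
    induction a generalizing c with
    | zero =>
      have := fibO_pos c
      simp only [fibO_zero, fibE_zero]
      omega
    | succ a ih =>
      cases c with
      | zero =>
        have := fibO_pos (a + 1)
        simp only [fibO_zero, fibE_zero]
        omega
      | succ c =>
        have := ih c
        simp only [fibO_succ, fibE_succ]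
        linarith
  simp only [stern_oddHigh, fibO_succ, fibE_succ]
  linarith

theorem stern_evenHigh_lt {b c : ℕ} (h : b ≤ c) :
    stern (evenHigh b (c + 1)) < stern (evenHigh (b + 1) c) := by
  have key : fibE b * fibO c + fibE b * fibE c < fibO b * fibO c + 2 * (fibO b * fibE c) := by
    induction b generalizing c with
    | zero =>
      have := fibO_pos c
      simp only [fibO_zero, fibE_zero]
      omega
    | succ b ih =>
      obtain ⟨c, rfl⟩ : ∃ d, c = d + 1 := ⟨c - 1, by omega⟩
      have := ih (c := c) (by omega)
      simp only [fibO_succ, fibE_succ]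
      linarith
  simp only [stern_evenHigh, fibO_succ, fibE_succ]
  linarith

/-- The form from `stern_evenHigh_lt` is again invariant along diagonals, but here the descent ends
at c = 0 with b > 0, where its sign is reversed. For b = c + 1 the two values are equal, so only the
first of them can be a record. -/
theorem stern_evenHigh_le {b c : ℕ} (h : c < b) :
    stern (evenHigh (b + 1) c) ≤ stern (evenHigh b (c + 1)) := by
  have key : fibO b * fibO c + 2 * (fibO b * fibE c) ≤ fibE b * fibO c + fibE b * fibE c := by
    induction c generalizing b with
    | zero =>
      obtain ⟨b, rfl⟩ : ∃ d, b = d + 1 := ⟨b - 1, by omega⟩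
      simp only [fibO_zero, fibE_zero, fibO_succ, fibE_succ]
      omega
    | succ c ih =>
      obtain ⟨b, rfl⟩ : ∃ d, b = d + 1 := ⟨b - 1, by omega⟩
      have := ih (b := b) (by omega)
      simp only [fibO_succ, fibE_succ]
      linarith
  simp only [stern_evenHigh, fibO_succ, fibE_succ]
  linarith

theorem stern_oddLow_lt {b c : ℕ} (h : b ≤ c) :
    stern (oddLow b (c + 1)) < stern (oddLow (b + 1) c) := by
  have key : 2 * (fibE b * fibO c) + fibE b * fibE c
      < fibO b * fibO c + 3 * (fibO b * fibE c) := by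
    induction b generalizing c with
    | zero =>
      have := fibO_pos c
      simp only [fibO_zero, fibE_zero]
      omega
    | succ b ih =>
      obtain ⟨c, rfl⟩ : ∃ d, c = d + 1 := ⟨c - 1, by omega⟩
      have := ih (c := c) (by omega)
      simp only [fibO_succ, fibE_succ]
      linarith
  simp only [stern_oddLow, fibO_succ, fibE_succ]
  linarith

theorem stern_oddLow_le {b c : ℕ} (h : c < b) :
    stern (oddLow (b + 1) c) ≤ stern (oddLow b (c + 1)) := by
  have key : fibO b * fibO c + 3 * (fibO b * fibE c)
      ≤ 2 * (fibE b * fibO c) + fibE b * fibE c := by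
    induction c generalizing b with
    | zero =>
      obtain ⟨b, rfl⟩ : ∃ d, b = d + 1 := ⟨b - 1, by omega⟩
      simp only [fibO_zero, fibE_zero, fibO_succ, fibE_succ]
      omega
    | succ c ih =>
      obtain ⟨b, rfl⟩ : ∃ d, b = d + 1 := ⟨b - 1, by omega⟩
      have := ih (b := b) (by omega)
      simp only [fibO_succ, fibE_succ]
      linarith
  simp only [stern_oddLow, fibO_succ, fibE_succ]
  linarith

/-- If `f i r` does not decrease under `(i, r + 1) ↦ (i + 1, r)` as long as `i ≤ r`, then it is
monotone along antidiagonals up to the middle. -/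
theorem antidiagonal_le_of_le {f : ℕ → ℕ → ℕ}
    (hf : ∀ i r, i ≤ r → f i (r + 1) ≤ f (i + 1) r) {i r m c : ℕ} (h : i + r = m + c)
    (him : i ≤ m) (hmc : m ≤ c + 1) : f i r ≤ f m c := by
  obtain ⟨d, rfl⟩ := Nat.exists_eq_add_of_le him
  obtain rfl : r = d + c := by omega
  clear h him
  induction d generalizing c with
  | zero => simp
  | succ d ih =>
    have h₁ := ih (c := c + 1) (by omega)
    rw [show d + 1 + c = d + (c + 1) by ring]
    exact h₁.trans (hf (i + d) c (by omega))

theorem antidiagonal_le_of_ge {f : ℕ → ℕ → ℕ}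
    (hf : ∀ i r, r < i → f (i + 1) r ≤ f i (r + 1)) {i r m c : ℕ} (h : i + r = m + c)
    (hmi : m ≤ i) (hcm : c ≤ m) : f i r ≤ f m c := by
  obtain ⟨d, rfl⟩ := Nat.exists_eq_add_of_le hmi
  obtain rfl : c = d + r := by omega
  clear h hmi
  induction d generalizing r with
  | zero => simp
  | succ d ih =>
    have h₁ := ih (r := r + 1) (by omega)
    rw [show d + 1 + r = d + (r + 1) by ring]
    exact (hf (m + d) r (by omega)).trans h₁

theorem stern_evenHigh_le_of_le {i r m c : ℕ} (h : i + r = m + c) (him : i ≤ m)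
    (hmc : m ≤ c + 1) : stern (evenHigh i r) ≤ stern (evenHigh m c) :=
  antidiagonal_le_of_le (f := fun i r => stern (evenHigh i r))
    (fun _ _ h => (stern_evenHigh_lt h).le) h him hmc

theorem stern_evenHigh_le_middle {i r m c : ℕ} (h : i + r = m + c) (hmc : m ≤ c + 1)
    (hcm : c ≤ m) : stern (evenHigh i r) ≤ stern (evenHigh m c) := by
  rcases le_total i m with him | him
  · exact stern_evenHigh_le_of_le h him hmc
  · exact antidiagonal_le_of_ge (f := fun i r => stern (evenHigh i r))
      (fun _ _ h => stern_evenHigh_le h) h him hcm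

theorem stern_oddLow_le_of_le {i r m c : ℕ} (h : i + r = m + c) (him : i ≤ m)
    (hmc : m ≤ c + 1) : stern (oddLow i r) ≤ stern (oddLow m c) :=
  antidiagonal_le_of_le (f := fun i r => stern (oddLow i r))
    (fun _ _ h => (stern_oddLow_lt h).le) h him hmc

theorem stern_oddLow_le_middle {i r m c : ℕ} (h : i + r = m + c) (hmc : m ≤ c + 1)
    (hcm : c ≤ m) : stern (oddLow i r) ≤ stern (oddLow m c) := by
  rcases le_total i m with him | him
  · exact stern_oddLow_le_of_le h him hmc
  · exact antidiagonal_le_of_ge (f := fun i r => stern (oddLow i r))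
      (fun _ _ h => stern_oddLow_le h) h him hcm

theorem stern_evenLow_le_of_le {i r a c : ℕ} (h : i + r = a + c) (hia : i ≤ a) :
    stern (evenLow i r) ≤ stern (evenLow a c) := by
  obtain ⟨d, rfl⟩ := Nat.exists_eq_add_of_le hia
  obtain rfl : r = d + c := by omega
  clear h hia
  induction d generalizing c with
  | zero => simp
  | succ d ih =>
    rw [show d + 1 + c = d + (c + 1) by ring]
    exact (ih (c := c + 1)).trans (stern_evenLow_lt (i + d) c).le

theorem stern_oddHigh_le_of_le {i r a c : ℕ} (h : i + r = a + c) (hia : i ≤ a) :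
    stern (oddHigh i r) ≤ stern (oddHigh a c) := by
  obtain ⟨d, rfl⟩ := Nat.exists_eq_add_of_le hia
  obtain rfl : r = d + c := by omega
  clear h hia
  induction d generalizing c with
  | zero => simp
  | succ d ih =>
    rw [show d + 1 + c = d + (c + 1) by ring]
    exact (ih (c := c + 1)).trans (stern_oddHigh_lt (i + d) c).le

/-! ### Values of the deviating expansions in terms of the families -/

theorem extE_block_four (i r : ℕ) :
    extE (stern (block 4 i)) (stern (block 4 i + 1)) r = stern (evenLow i r) := by
  rw [(stern_block_four i).1, (stern_block_four i).2, extE, stern_evenLow]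
  ring

theorem extO_block_four (i r : ℕ) :
    extO (stern (block 4 i)) (stern (block 4 i + 1)) r = stern (oddLow i r) := by
  rw [(stern_block_four i).1, (stern_block_four i).2, extO, stern_oddLow]
  ring

theorem extO_block_zero (i r : ℕ) :
    extO (stern (block 0 i)) (stern (block 0 i + 1)) r = stern (evenHigh i r) := by
  rw [(stern_block_zero i).1, (stern_block_zero i).2, extO, stern_evenHigh]
  ring

theorem extE_block_zero_succ (i r : ℕ) :
    extE (stern (block 0 (i + 1))) (stern (block 0 (i + 1) + 1)) r = stern (oddHigh i r) := by
  rw [(stern_block_zero _).1, (stern_block_zero _).2, fibO_succ, fibE_succ, extE, stern_oddHigh]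
  ring

theorem extE_zero_one (r : ℕ) : extE 0 1 r = stern (evenLast r) := by
  rw [extE, stern_evenLast]
  ring

theorem extO_zero_one (r : ℕ) : extO 0 1 r = stern (oddLast r) := by
  rw [extO, stern_oddLast]
  ring

/-! ### Comparison of the remaining deviating expansions with the record values -/

theorem extO_block_eight_le (j r : ℕ) :
    extO (stern (block 8 j)) (stern (block 8 j + 1)) r ≤ stern (oddLast (j + r + 2)) := by
  -- In terms of j and r the difference contains - `fibE j * fibE r`. Peeling one step off each
  -- index leaves only nonnegative coefficients, and passing to ℤ makes the subtraction exact. The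
  -- lemmas below follow the same pattern, with deeper splits where needed.
  rcases j with _ | j <;> rcases r with _ | r
  all_goals
    simp only [stern_block_eight, extO, stern_oddLast, fibO_add_eq, fibE_add, fibO_succ,
      fibE_succ, fibO_zero, fibE_zero]
    rw [← Nat.cast_le (α := ℤ), ← sub_nonneg]
    push_cast <;> ring_nf <;> positivity

theorem extO_block_two_mul_block_four_le (a j r : ℕ) :
    extO (stern (block (2 * block 4 (a + 1)) j)) (stern (block (2 * block 4 (a + 1)) j + 1)) r
      ≤ stern (evenLow a (j + r + 1)) := by
  rcases a with _ | a <;> rcases j with _ | _ | j <;> rcases r with _ | r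
  all_goals
    simp only [stern_block (2 * block 4 _), stern_two_mul_block_four, extO, stern_evenLow,
      fibO_add_eq, fibE_add, fibO_succ, fibE_succ, fibO_zero, fibE_zero]
    rw [← Nat.cast_le (α := ℤ), ← sub_nonneg]
    push_cast <;> ring_nf <;> positivity

theorem extE_block_two_mul_block_zero_le (b j r : ℕ) :
    extE (stern (block (2 * block 0 (b + 2)) j)) (stern (block (2 * block 0 (b + 2)) j + 1)) r
      ≤ stern (evenHigh (b + 1) (j + r + 2)) := by
  rcases b with _ | b <;> rcases j with _ | j <;> rcases r with _ | r
  all_goals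
    simp only [stern_block (2 * block 0 _), stern_two_mul_block_zero, extE, stern_evenHigh,
      fibO_add_eq, fibE_add, fibO_succ, fibE_succ, fibO_zero, fibE_zero]
    rw [← Nat.cast_le (α := ℤ), ← sub_nonneg]
    push_cast <;> ring_nf <;> positivity

theorem extE_block_eight_le (j r : ℕ) :
    extE (stern (block 8 j)) (stern (block 8 j + 1)) r ≤ stern (evenLast (j + r + 2)) := by
  rcases j with _ | _ | j <;> rcases r with _ | r
  all_goals
    simp only [stern_block_eight, extE, stern_evenLast, fibO_add_eq, fibE_add, fibO_succ,
      fibE_succ, fibO_zero, fibE_zero]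
    rw [← Nat.cast_le (α := ℤ), ← sub_nonneg]
    push_cast <;> ring_nf <;> positivity

/-- The shift `r + 1` is essential: for r = 0 the left side would be exactly the value of
`oddSporadic j`, which eventually exceeds that of `oddLow 0`. -/
theorem extE_block_thirtySix_le_oddLow (j r : ℕ) :
    extE (stern (block 36 j)) (stern (block 36 j + 1)) (r + 1)
      ≤ stern (oddLow 0 (j + r + 3)) := by
  rcases j with _ | _ | j <;> rcases r with _ | r
  all_goals
    simp only [stern_block_thirtySix, extE, stern_oddLow, fibO_add_eq, fibE_add, fibO_succ,
      fibE_succ, fibO_zero, fibE_zero]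
    rw [← Nat.cast_le (α := ℤ), ← sub_nonneg]
    push_cast <;> ring_nf <;> positivity

theorem two_mul_stern_two_mul_block_thirtySix_add_le (c : ℕ) :
    2 * stern (2 * block 36 c) + stern (2 * block 36 c + 1) ≤ stern (oddLow 0 (c + 2)) := by
  simp only [stern_two_mul, stern_two_mul_add_one, stern_block_thirtySix, stern_oddLow,
    fibO_succ, fibE_succ, fibO_zero, fibE_zero]
  rw [← Nat.cast_le (α := ℤ), ← sub_nonneg]
  push_cast
  ring_nf
  positivity

theorem extE_block_thirtySix_le_oddSporadic (j r : ℕ) :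
    extE (stern (block 36 j)) (stern (block 36 j + 1)) r ≤ stern (oddSporadic (j + r)) := by
  rcases j with _ | j <;> rcases r with _ | r
  all_goals
    simp only [stern_block_thirtySix, extE, stern_oddSporadic, fibO_add_eq, fibE_add, fibO_succ,
      fibE_succ, fibO_zero, fibE_zero]
    rw [← Nat.cast_le (α := ℤ), ← sub_nonneg]
    push_cast <;> ring_nf <;> positivity

theorem extE_block_two_mul_block_four_le (b j r : ℕ) :
    extE (stern (block (2 * block 4 (b + 2)) j)) (stern (block (2 * block 4 (b + 2)) j + 1)) r
      ≤ stern (oddLow (b + 1) (j + r + 2)) := by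
  rcases b with _ | b <;> rcases j with _ | j <;> rcases r with _ | r
  all_goals
    simp only [stern_block (2 * block 4 _), stern_two_mul_block_four, extE, stern_oddLow,
      fibO_add_eq, fibE_add, fibO_succ, fibE_succ, fibO_zero, fibE_zero]
    rw [← Nat.cast_le (α := ℤ), ← sub_nonneg]
    push_cast <;> ring_nf <;> positivity

theorem extO_block_two_mul_block_zero_le (a j r : ℕ) :
    extO (stern (block (2 * block 0 (a + 2)) j)) (stern (block (2 * block 0 (a + 2)) j + 1)) r
      ≤ stern (oddHigh a (j + r + 1)) := by
  rcases a with _ | a <;> rcases j with _ | j <;> rcases r with _ | r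
  all_goals
    simp only [stern_block (2 * block 0 _), stern_two_mul_block_zero, extO, stern_oddHigh,
      fibO_add_eq, fibE_add, fibO_succ, fibE_succ, fibO_zero, fibE_zero]
    rw [← Nat.cast_le (α := ℤ), ← sub_nonneg]
    push_cast <;> ring_nf <;> positivity

/-! ### Strict increase from one family to another -/

theorem stern_oddLast_lt_evenLow (c : ℕ) :
    stern (oddLast (c + 2)) < stern (evenLow 0 c) := by
  -- Writing `fibO c` as `pc + 1` supplies the constant term that absorbs the + 1 of the strict
  -- inequality.
  obtain ⟨pc, hc⟩ := Nat.exists_eq_succ_of_ne_zero (fibO_pos c).ne'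
  rw [Nat.lt_iff_add_one_le]
  simp only [stern_oddLast, stern_evenLow, fibO_succ, fibE_succ, fibO_zero, fibE_zero, hc]
  rw [← Nat.cast_le (α := ℤ), ← sub_nonneg]
  push_cast
  ring_nf
  positivity

theorem stern_evenLow_lt_evenHigh (a : ℕ) :
    stern (evenLow a 0) < stern (evenHigh 1 (a + 1)) := by
  obtain ⟨pa, ha⟩ := Nat.exists_eq_succ_of_ne_zero (fibO_pos a).ne'
  rw [Nat.lt_iff_add_one_le]
  simp only [stern_evenHigh, stern_evenLow, fibO_succ, fibE_succ, fibO_zero, fibE_zero, ha]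
  rw [← Nat.cast_le (α := ℤ), ← sub_nonneg]
  push_cast
  ring_nf
  positivity

theorem stern_evenHigh_lt_evenLast (b c : ℕ) :
    stern (evenHigh b c) < stern (evenLast (b + c)) := by
  obtain ⟨pb, hb⟩ := Nat.exists_eq_succ_of_ne_zero (fibO_pos b).ne'
  obtain ⟨pc, hc⟩ := Nat.exists_eq_succ_of_ne_zero (fibO_pos c).ne'
  rw [Nat.lt_iff_add_one_le]
  simp only [stern_evenHigh, stern_evenLast, fibO_add_eq, fibE_add, hb, hc]
  rw [← Nat.cast_le (α := ℤ), ← sub_nonneg]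
  push_cast
  ring_nf
  positivity

theorem stern_evenLast_lt_oddLow (c : ℕ) :
    stern (evenLast (c + 2)) < stern (oddLow 0 (c + 1)) := by
  obtain ⟨pc, hc⟩ := Nat.exists_eq_succ_of_ne_zero (fibO_pos c).ne'
  rw [Nat.lt_iff_add_one_le]
  simp only [stern_evenLast, stern_oddLow, fibO_succ, fibE_succ, fibO_zero, fibE_zero, hc]
  rw [← Nat.cast_le (α := ℤ), ← sub_nonneg]
  push_cast
  ring_nf
  positivity

/-- This is where small k must be excluded: `oddLow 0 3` and `oddSporadic 1` both have value 97, and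
`oddLow 0 2` even beats `oddSporadic 0`. -/
theorem stern_oddLow_lt_oddSporadic (c : ℕ) :
    stern (oddLow 0 (c + 4)) < stern (oddSporadic (c + 2)) := by
  obtain ⟨pc, hc⟩ := Nat.exists_eq_succ_of_ne_zero (fibO_pos c).ne'
  rw [Nat.lt_iff_add_one_le]
  simp only [stern_oddSporadic, stern_oddLow, fibO_succ, fibE_succ, fibO_zero, fibE_zero, hc]
  rw [← Nat.cast_le (α := ℤ), ← sub_nonneg]
  push_cast
  ring_nf
  positivity

theorem stern_oddSporadic_lt_oddLow (c : ℕ) :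
    stern (oddSporadic c) < stern (oddLow 1 (c + 1)) := by
  obtain ⟨pc, hc⟩ := Nat.exists_eq_succ_of_ne_zero (fibO_pos c).ne'
  rw [Nat.lt_iff_add_one_le]
  simp only [stern_oddSporadic, stern_oddLow, fibO_succ, fibE_succ, fibO_zero, fibE_zero, hc]
  rw [← Nat.cast_le (α := ℤ), ← sub_nonneg]
  push_cast
  ring_nf
  positivity

theorem stern_oddLow_lt_oddHigh (b c : ℕ) :
    stern (oddLow b c) < stern (oddHigh 0 (b + c)) := by
  obtain ⟨pb, hb⟩ := Nat.exists_eq_succ_of_ne_zero (fibO_pos b).ne'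
  obtain ⟨pc, hc⟩ := Nat.exists_eq_succ_of_ne_zero (fibO_pos c).ne'
  rw [Nat.lt_iff_add_one_le]
  simp only [stern_oddHigh, stern_oddLow, fibO_add_eq, fibE_add, fibO_zero, fibE_zero, hb, hc]
  rw [← Nat.cast_le (α := ℤ), ← sub_nonneg]
  push_cast
  ring_nf
  positivity

theorem stern_oddHigh_lt_oddLast (a : ℕ) :
    stern (oddHigh a 0) < stern (oddLast (a + 2)) := by
  obtain ⟨pa, ha⟩ := Nat.exists_eq_succ_of_ne_zero (fibO_pos a).ne'
  rw [Nat.lt_iff_add_one_le]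
  simp only [stern_oddHigh, stern_oddLast, fibO_succ, fibE_succ, fibO_zero, fibE_zero, ha]
  rw [← Nat.cast_le (α := ℤ), ← sub_nonneg]
  push_cast
  ring_nf
  positivity

theorem stern_evenLast_lt_oddHigh (c : ℕ) :
    stern (evenLast (c + 1)) < stern (oddHigh 0 c) := by
  obtain ⟨pc, hc⟩ := Nat.exists_eq_succ_of_ne_zero (fibO_pos c).ne'
  rw [Nat.lt_iff_add_one_le]
  simp only [stern_oddHigh, stern_evenLast, fibO_succ, fibE_succ, fibO_zero, fibE_zero, hc]
  rw [← Nat.cast_le (α := ℤ), ← sub_nonneg]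
  push_cast
  ring_nf
  positivity

/-! ### Bounds before the record-setters -/

theorem SternLE.of_fib {C l : ℕ} (h : Nat.fib (l + 1) ≤ C) : SternLE C 1 l :=
  fun i hi => (stern_le_fib l i (by omega)).trans h

/-- The two zeros of 100 cost nothing; only the numbers with fewer digits remain, and they obey the
Fibonacci bound. -/
theorem sternLE_four {C l : ℕ} (h : Nat.fib (l + 3) ≤ C) : SternLE C 4 l :=
  SternLE.two_mul (SternLE.two_mul (SternLE.of_fib (l := l + 2) h))

theorem sternLE_evenLow {C a c : ℕ} (h₀ : stern (oddLast (a + c + 2)) ≤ C)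
    (h₁ : ∀ i r, i + r = a + c → i < a → stern (evenLow i r) ≤ C)
    (h₂ : ∀ j r, j + r = c → extO (stern (block (2 * block 4 a) j))
      (stern (block (2 * block 4 a) j + 1)) r ≤ C) :
    SternLE C (evenLow a c) 0 := by
  refine sternLE_block_one_one (SternLE.two_mul (sternLE_block_odd (s := c + 1)
    (sternLE_four (le_of_eq_of_le ?_ h₀)) fun j r hj => ?_)) h₂
  · rw [stern_oddLast, show 2 * (a + (c + 1)) + 1 + 3 = 2 * (a + c + 2 + 1) by ring,
      fib_two_mul_eq, fibE_succ]
  · rw [extE_block_four]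
    exact h₁ _ _ (by omega) (by omega)

theorem sternLE_two_mul_block_four_odd {C b c : ℕ} (h₀ : stern (evenLast (b + c + 1)) ≤ C)
    (h₁ : ∀ i r, i + r = b + c → i < b → stern (oddLow i r) ≤ C) :
    SternLE C (2 * block 4 b) (2 * c + 1) := by
  refine SternLE.two_mul (sternLE_block_even (s := c + 1)
    (sternLE_four (le_of_eq_of_le ?_ h₀)) fun j r hj => ?_)
  · rw [stern_evenLast, show 2 * (b + (c + 1)) + 3 = 2 * (b + c + 1 + 1) + 1 by ring,
      fib_two_mul_add_one_eq]
    simp only [fibO_succ, fibE_succ]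
    ring
  · rw [extO_block_four]
    exact h₁ _ _ (by omega) (by omega)

theorem sternLE_oddLow {C b c : ℕ} (h₀ : stern (evenLast (b + c + 1)) ≤ C)
    (h₁ : ∀ i r, i + r = b + c → i < b → stern (oddLow i r) ≤ C)
    (h₂ : ∀ j r, j + r + 1 = c → extE (stern (block (2 * block 4 b) j))
      (stern (block (2 * block 4 b) j + 1)) r ≤ C) :
    SternLE C (oddLow b c) 0 :=
  sternLE_block_one (sternLE_two_mul_block_four_odd h₀ h₁) h₂

theorem sternLE_evenHigh {C b c : ℕ}
    (h₁ : ∀ i r, i + r = b + c → i < b → stern (evenHigh i r) ≤ C)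
    (h₂ : ∀ j r, j + r + 1 = c → extE (stern (block (2 * block 0 b) j))
      (stern (block (2 * block 0 b) j + 1)) r ≤ C) :
    SternLE C (evenHigh b c) 0 := by
  refine sternLE_block_one (SternLE.two_mul (sternLE_block_even (s := c + 1)
    (SternLE.zero _ _) fun j r hj => ?_)) h₂
  rw [extO_block_zero]
  exact h₁ _ _ (by omega) (by omega)

theorem sternLE_oddHigh {C a c : ℕ} (h₀ : stern (evenLast (a + c + 1)) ≤ C)
    (h₁ : ∀ i r, i + r = a + c → i < a → stern (oddHigh i r) ≤ C)
    (h₂ : ∀ j r, j + r = c → extO (stern (block (2 * block 0 (a + 1)) j))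
      (stern (block (2 * block 0 (a + 1)) j + 1)) r ≤ C) :
    SternLE C (oddHigh a c) 0 := by
  refine sternLE_block_one_one (SternLE.two_mul (sternLE_block_odd (s := c + 1)
    (SternLE.zero _ _) fun j r hj => ?_)) h₂
  cases j with
  | zero =>
    rw [block_zero, stern_zero, zero_add, stern_one, extE_zero_one]
    convert h₀ using 3
    omega
  | succ j =>
    rw [extE_block_zero_succ]
    exact h₁ _ _ (by omega) (by omega)

/-! ### Consecutive record-setters -/

/-- If `u` is a record-setter, then `v` is the next one. -/
def IsNextRecord (u v : ℕ) : Prop :=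
  u < v ∧ stern u < stern v ∧ SternLE (stern u) v 0

theorem isNextRecord_evenLow_zero (c : ℕ) : IsNextRecord (oddLast (c + 2)) (evenLow 0 c) := by
  refine ⟨?_, stern_oddLast_lt_evenLow c, sternLE_evenLow (by rw [zero_add])
    (fun i r _ hi => absurd hi (by omega)) fun j r hj => ?_⟩
  -- Both closed forms are expressed through the same power 4^c, so the order becomes linear
  -- arithmetic.
  · have h₀ := three_mul_block 0 (c + 2)
    have h₈ := three_mul_block 8 c
    rw [pow_add] at h₀
    simp only [oddLast, evenLow, block_zero, Nat.reduceMul]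
    omega
  · subst hj
    exact extO_block_eight_le j r

theorem isNextRecord_evenLow_succ (a c : ℕ) :
    IsNextRecord (evenLow a (c + 1)) (evenLow (a + 1) c) := by
  refine ⟨?_, stern_evenLow_lt a c, sternLE_evenLow ?_
    (fun i r h hi => stern_evenLow_le_of_le (by omega) (by omega)) fun j r hj => ?_⟩
  -- The defect moves right by one block: after a common prefix, 0 10 is replaced by 10 0.
  · have := block_lt_block (show 4 * (2 * block 4 a) + 2 < 2 * block 4 (a + 1) by
      rw [block_succ]; omega) c
    rw [evenLow, evenLow, block_succ']
    omega
  · rw [show a + 1 + c = a + c + 1 by ring]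
    exact (stern_oddLast_lt_evenLow _).le.trans (stern_evenLow_le_of_le (by omega) (by omega))
  · subst hj
    exact extO_block_two_mul_block_four_le a j r

theorem isNextRecord_evenHigh_one (a : ℕ) :
    IsNextRecord (evenLow a 0) (evenHigh 1 (a + 1)) := by
  refine ⟨?_, stern_evenLow_lt_evenHigh a, sternLE_evenHigh (fun i r h hi => ?_)
    fun j r hj => ?_⟩
  · change 4 * (2 * block 4 a) + 3 < 2 * (4 * block 4 a + 2) + 1
    omega
  · obtain rfl : i = 0 := by omega
    obtain rfl : r = a + 2 := by omega
    rw [← extO_block_zero, block_zero, stern_zero, zero_add, stern_one, extO_zero_one]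
    exact (stern_oddLast_lt_evenLow a).le.trans (stern_evenLow_le_of_le (by omega) (by omega))
  -- The prefix `2 * block 0 1` is 4, so deviations in the second run have members of `evenLow` as
  -- bounds.
  · exact (extE_block_four j r).trans_le (stern_evenLow_le_of_le (by omega) (by omega))

theorem isNextRecord_evenHigh_succ {b c : ℕ} (h : b + 1 ≤ c) :
    IsNextRecord (evenHigh (b + 1) (c + 1)) (evenHigh (b + 2) c) := by
  refine ⟨?_, stern_evenHigh_lt h, sternLE_evenHigh
    (fun i r h hi => stern_evenHigh_le_of_le (by omega) (by omega) (by omega)) fun j r hj => ?_⟩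
  · have := block_lt_block (show 4 * (2 * block 0 (b + 1)) + 2 < 2 * block 0 (b + 2) by
      rw [block_succ 0 (b + 1)]; omega) c
    rw [evenHigh, evenHigh, block_succ']
    omega
  · subst hj
    exact extE_block_two_mul_block_zero_le b j r

theorem two_mul_block_two_mul_lt (q c : ℕ) : 2 * block (2 * q) c + 1 < 4 * block q c + 3 := by
  have h₁ := three_mul_block (2 * q) c
  have h₂ := three_mul_block q c
  nlinarith [Nat.zero_le (4 ^ c)]

theorem isNextRecord_evenLast {b c : ℕ} (h₁ : b ≤ c + 1) (h₂ : c ≤ b) :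
    IsNextRecord (evenHigh b c) (evenLast (b + c)) := by
  refine ⟨?_, stern_evenHigh_lt_evenLast b c, sternLE_block_one_one (SternLE.zero _ _)
    fun j r hj => ?_⟩
  · rw [evenLast, block_add]
    exact two_mul_block_two_mul_lt _ _
  · rw [extO_block_zero]
    exact stern_evenHigh_le_middle hj h₁ h₂

theorem isNextRecord_oddLow_zero (c : ℕ) :
    IsNextRecord (evenLast (c + 2)) (oddLow 0 (c + 1)) := by
  refine ⟨?_, stern_evenLast_lt_oddLow c, sternLE_oddLow (by rw [zero_add])
    (fun i r _ hi => absurd hi (by omega)) fun j r hj => ?_⟩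
  · have h₀ := three_mul_block 0 (c + 2)
    have h₈ := three_mul_block 8 (c + 1)
    rw [pow_add] at h₀ h₈
    simp only [evenLast, oddLow, block_zero, Nat.reduceMul]
    omega
  · obtain rfl : c = j + r := by omega
    exact extE_block_eight_le j r

/-- The prefix 100100 is `2 * block 4 1`, so the bound in front of it is that for `oddLow 1`. The
blocks and the first 1 of the ending 011 are then treated separately. -/
theorem isNextRecord_oddSporadic (c : ℕ) :
    IsNextRecord (oddLow 0 (c + 4)) (oddSporadic (c + 2)) := by
  refine ⟨?_, stern_oddLow_lt_oddSporadic c, ?_⟩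
  · have h₀ := three_mul_block 8 (c + 4)
    have h₈ := three_mul_block 36 (c + 2)
    rw [pow_add] at h₀ h₈
    simp only [oddSporadic, oddLow, block_zero, Nat.reduceMul]
    omega
  · rw [oddSporadic, show 8 * block 36 (c + 2) + 3
      = 2 * (2 * (2 * block 36 (c + 2)) + 1) + 1 by ring]
    refine SternLE.last (SternLE.two_mul_add_one (SternLE.two_mul
      (sternLE_block_odd (s := 1) ?_ fun j r hj => ?_)) ?_)
    · refine sternLE_two_mul_block_four_odd (b := 1) (c := c + 3) ?_ fun i r h hi => ?_
      · rw [show 1 + (c + 3) + 1 = c + 3 + 2 by ring]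
        exact (stern_evenLast_lt_oddLow _).le
      · obtain rfl : i = 0 := by omega
        obtain rfl : r = c + 4 := by omega
        exact le_rfl
    · have := extE_block_thirtySix_le_oddLow j r
      rwa [show j + r + 3 = c + 4 by omega] at this
    · exact le_of_eq_of_le (by norm_num [Nat.fib_add_two])
        (two_mul_stern_two_mul_block_thirtySix_add_le (c + 2))

theorem isNextRecord_oddLow_one (c : ℕ) :
    IsNextRecord (oddSporadic (c + 2)) (oddLow 1 (c + 3)) := by
  have h := (stern_oddLow_lt_oddSporadic c).le
  refine ⟨?_, stern_oddSporadic_lt_oddLow (c + 2), sternLE_oddLow ?_ (fun i r hr hi => ?_)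
    fun j r hj => ?_⟩
  · change 8 * block 36 (c + 2) + 3 < 2 * (4 * block 36 (c + 2) + 2) + 1
    omega
  · rw [show 1 + (c + 3) + 1 = c + 3 + 2 by ring]
    exact (stern_evenLast_lt_oddLow _).le.trans h
  · obtain rfl : i = 0 := by omega
    obtain rfl : r = c + 4 := by omega
    exact h
  · have := extE_block_thirtySix_le_oddSporadic j r
    rwa [show j + r = c + 2 by omega] at this

theorem isNextRecord_oddLow_succ {b c : ℕ} (h : b + 1 ≤ c) :
    IsNextRecord (oddLow (b + 1) (c + 1)) (oddLow (b + 2) c) := by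
  refine ⟨?_, stern_oddLow_lt h, sternLE_oddLow ?_
    (fun i r h hi => stern_oddLow_le_of_le (by omega) (by omega) (by omega)) fun j r hj => ?_⟩
  · have := block_lt_block (show 4 * (2 * block 4 (b + 1)) + 2 < 2 * block 4 (b + 2) by
      rw [block_succ 4 (b + 1)]; omega) c
    rw [oddLow, oddLow, block_succ']
    omega
  · rw [show b + 2 + c + 1 = b + c + 1 + 2 by ring]
    exact (stern_evenLast_lt_oddLow _).le.trans
      (stern_oddLow_le_of_le (by omega) (by omega) (by omega))
  · subst hj
    exact extE_block_two_mul_block_four_le b j r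

theorem isNextRecord_oddHigh_zero {b c : ℕ} (h₀ : 0 < b + c) (h₁ : b ≤ c + 1) (h₂ : c ≤ b) :
    IsNextRecord (oddLow b c) (oddHigh 0 (b + c)) := by
  refine ⟨?_, stern_oddLow_lt_oddHigh b c, sternLE_oddHigh ?_
    (fun i r _ hi => absurd hi (by omega)) fun j r hj => ?_⟩
  · rw [oddHigh, show 2 * block 0 (0 + 1) = 4 by rfl, block_add]
    exact two_mul_block_two_mul_lt _ _
  · obtain ⟨d, hd⟩ : ∃ d, b + c = d + 1 := ⟨b + c - 1, by omega⟩
    rw [zero_add, hd]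
    exact (stern_evenLast_lt_oddLow d).le.trans (stern_oddLow_le_of_le (by omega) (by omega) h₁)
  -- Here the deviations run over the whole antidiagonal of `oddLow`, beyond the middle too, so the
  -- decreasing half is needed.
  · exact (extO_block_four j r).trans_le (stern_oddLow_le_middle hj h₁ h₂)

theorem isNextRecord_oddHigh_succ (a c : ℕ) :
    IsNextRecord (oddHigh a (c + 1)) (oddHigh (a + 1) c) := by
  refine ⟨?_, stern_oddHigh_lt a c, sternLE_oddHigh ?_
    (fun i r h hi => stern_oddHigh_le_of_le (by omega) (by omega)) fun j r hj => ?_⟩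
  · have := block_lt_block (show 4 * (2 * block 0 (a + 1)) + 2 < 2 * block 0 (a + 1 + 1) by
      rw [block_succ 0 (a + 1)]; omega) c
    rw [oddHigh, oddHigh, block_succ']
    omega
  · exact (stern_evenLast_lt_oddHigh _).le.trans (stern_oddHigh_le_of_le (by omega) (by omega))
  · subst hj
    exact extO_block_two_mul_block_zero_le a j r

theorem isNextRecord_oddLast (a : ℕ) : IsNextRecord (oddHigh a 0) (oddLast (a + 2)) := by
  refine ⟨?_, stern_oddHigh_lt_oddLast a, sternLE_block_one (SternLE.zero _ _) fun j r hj => ?_⟩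
  · simp only [oddHigh, oddLast, block_zero, block_succ]
    omega
  · cases j with
    | zero =>
      rw [block_zero, stern_zero, zero_add, stern_one, extE_zero_one]
      obtain rfl : r = a + 1 := by omega
      exact (stern_evenLast_lt_oddHigh _).le.trans (stern_oddHigh_le_of_le (by omega) (by omega))
    | succ j =>
      rw [extE_block_zero_succ]
      exact stern_oddHigh_le_of_le (by omega) (by omega)

/-! ### Lists of consecutive record-setters -/

/-- If `u` is a record-setter, then `l` lists the record-setters in `(u, N)`. -/
inductive IsRecordList (N : ℕ) : ℕ → List ℕ → Prop
  | nil {u : ℕ} (hu : u < N) (h : SternLE (stern u) N 0) : IsRecordList N u []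
  | cons {u v : ℕ} {l : List ℕ} (h : IsNextRecord u v) (hl : IsRecordList N v l) :
      IsRecordList N u (v :: l)

theorem SternLE.stern_le {C v : ℕ} (h : SternLE C v 0) {i : ℕ} (hi : i < v) : stern i ≤ C :=
  h i (by simpa using hi)

/-- It is not needed that u is a record-setter: everything before v is at most `stern u`, which is
smaller than `stern v`. Hence a chain may start anywhere. -/
theorem IsNextRecord.isRecordSetter {u v : ℕ} (h : IsNextRecord u v) :
    IsRecordSetter stern v :=
  fun _ hi => (h.2.2.stern_le hi).trans_lt h.2.1

namespace IsRecordList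

theorem lt {N u : ℕ} {l : List ℕ} (h : IsRecordList N u l) : u < N := by
  induction h with
  | nil hu _ => exact hu
  | cons h _ ih => exact h.1.trans ih

theorem mem_iff {N u : ℕ} {l : List ℕ} (h : IsRecordList N u l) (x : ℕ) :
    x ∈ l ↔ u < x ∧ x < N ∧ IsRecordSetter stern x := by
  induction h with
  | nil hu h =>
    simp only [List.not_mem_nil, false_iff]
    rintro ⟨h₁, h₂, h₃⟩
    exact (h₃ _ h₁).not_ge (h.stern_le h₂)
  | @cons u v l h hl ih =>
    rw [List.mem_cons, ih]
    constructor
    · rintro (rfl | ⟨h₁, h₂⟩)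
      · exact ⟨h.1, hl.lt, h.isRecordSetter⟩
      · exact ⟨h.1.trans h₁, h₂⟩
    · rintro ⟨h₁, h₂, h₃⟩
      rcases lt_trichotomy x v with hx | hx | hx
      · exact absurd (h₃ _ h₁) (h.2.2.stern_le hx).not_gt
      · exact Or.inl hx
      · exact Or.inr ⟨hx, h₂, h₃⟩

theorem pairwise {N u : ℕ} {l : List ℕ} (h : IsRecordList N u l) : l.Pairwise (· < ·) := by
  induction h with
  | nil => exact List.Pairwise.nil
  | cons h hl ih => exact List.Pairwise.cons (fun x hx => ((hl.mem_iff x).1 hx).1) ih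

theorem sternRecordSetters_eq {k u v : ℕ} {l : List ℕ} (h : IsRecordList (2 ^ k) u (v :: l))
    (hu : u < 2 ^ (k - 1)) (hv : 2 ^ (k - 1) ≤ v) : sternRecordSetters k = v :: l := by
  have hs : ((Finset.Ico (2 ^ (k - 1)) (2 ^ k)).filter (IsRecordSetter stern))
      = (v :: l).toFinset := by
    ext x
    rw [List.mem_toFinset, h.mem_iff, Finset.mem_filter, Finset.mem_Ico]
    refine ⟨fun hx => ⟨hu.trans_le hx.1.1, hx.1.2, hx.2⟩, fun hx => ⟨⟨?_, hx.2.1⟩, hx.2.2⟩⟩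
    rcases List.mem_cons.1 ((h.mem_iff x).2 hx) with rfl | hx'
    · exact hv
    · exact hv.trans (List.rel_of_pairwise_cons h.pairwise hx').le
  rw [sternRecordSetters, hs]
  exact (List.toFinset_sort (r := (· ≤ ·)) (h.pairwise.imp ne_of_lt)).2 (h.pairwise.imp le_of_lt)

/-- Induction on a downwards from b: the tail hangs on the last member `f b`, and members are
prepended. -/
theorem map_append {N u a b : ℕ} {f : ℕ → ℕ} {l : List ℕ} (hab : a ≤ b)
    (hu : IsNextRecord u (f a)) (hf : ∀ i, a ≤ i → i < b → IsNextRecord (f i) (f (i + 1)))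
    (hl : IsRecordList N (f b) l) :
    IsRecordList N u ((List.Ico a (b + 1)).map f ++ l) := by
  induction hab using Nat.decreasingInduction generalizing u with
  | self =>
    rw [List.Ico.succ_singleton]
    exact cons hu hl
  | of_succ a hab ih =>
    rw [List.Ico.eq_cons (by omega)]
    exact cons hu (ih (hf a le_rfl hab) fun i hi => hf i (by omega))

end IsRecordList

theorem three_mul_evenLast (c : ℕ) : 3 * evenLast c = 2 ^ (2 * c + 3) + 1 := by
  have := three_mul_block 0 c
  rw [pow_add, pow_mul, evenLast]
  norm_num
  omega

theorem three_mul_oddLast (c : ℕ) : 3 * oddLast c = 2 ^ (2 * c + 2) - 1 := by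
  have := three_mul_block 0 c
  rw [pow_add, pow_mul, oddLast]
  norm_num
  omega

theorem sternRecordSetters_two_mul {n : ℕ} (hn : 3 ≤ n) :
    sternRecordSetters (2 * n) =
      (List.Ico 0 (n - 3 + 1)).map (fun a => evenLow a (n - 3 - a))
        ++ (List.Ico 1 (n / 2 + 1)).map (fun b => evenHigh b (n - 1 - b))
        ++ [evenLast (n - 1)] := by
  have hE := three_mul_evenLast (n - 1)
  have hO := three_mul_oddLast (n - 1)
  have hp := Nat.one_le_two_pow (n := 2 * n - 1)
  rw [show 2 * (n - 1) + 3 = 2 * n - 1 + 2 by omega, pow_add] at hE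
  rw [show 2 * (n - 1) + 2 = 2 * n - 1 + 1 by omega, pow_add] at hO
  have hN : 2 ^ (2 * n) = 2 * 2 ^ (2 * n - 1) := by
    rw [← pow_succ', show 2 * n - 1 + 1 = 2 * n by omega]
  have h : IsRecordList (2 ^ (2 * n)) (oddLast (n - 1))
      ((List.Ico 0 (n - 3 + 1)).map (fun a => evenLow a (n - 3 - a))
        ++ ((List.Ico 1 (n / 2 + 1)).map (fun b => evenHigh b (n - 1 - b))
        ++ [evenLast (n - 1)])) := by
    refine IsRecordList.map_append (Nat.zero_le _) ?_ (fun i _ hi => ?_)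
      (IsRecordList.map_append (by omega) ?_ (fun i hi hi' => ?_)
        (IsRecordList.cons ?_ (IsRecordList.nil (by omega) fun i hi => ?_)))
    · have := isNextRecord_evenLow_zero (n - 3)
      rwa [show n - 3 + 2 = n - 1 by omega] at this
    · have := isNextRecord_evenLow_succ i (n - 3 - (i + 1))
      rwa [show n - 3 - (i + 1) + 1 = n - 3 - i by omega] at this
    · have := isNextRecord_evenHigh_one (n - 3)
      -- The second argument 0 of the last `evenLow` is rewritten as the value of the family's
      -- second parameter at index n - 3.
      rwa [show n - 3 + 1 = n - 1 - 1 by omega, ← Nat.sub_self (n - 3)] at this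
    · obtain ⟨i, rfl⟩ := Nat.exists_eq_add_of_le' hi
      have := isNextRecord_evenHigh_succ (b := i) (c := n - 1 - (i + 2)) (by omega)
      rwa [show n - 1 - (i + 2) + 1 = n - 1 - (i + 1) by omega] at this
    · have := isNextRecord_evenLast (b := n / 2) (c := n - 1 - n / 2) (by omega) (by omega)
      rwa [show n / 2 + (n - 1 - n / 2) = n - 1 by omega] at this
    -- The last member attains F_{2n+1}, the Fibonacci bound on all of [0, 2^(2n)], so no later
    -- record fits.
    · refine (stern_le_fib (2 * n) i (by omega)).trans_eq ?_
      rw [stern_evenLast, fib_two_mul_add_one_eq]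
      obtain ⟨n, rfl⟩ := Nat.exists_eq_add_of_le' (show 1 ≤ n by omega)
      rw [Nat.add_sub_cancel, fibO_succ, fibE_succ]
      ring
  rw [List.append_assoc]
  have h0 : 2 ^ (2 * n - 1) ≤ evenLow 0 (n - 3 - 0) := by
    have := three_mul_block 8 (n - 3)
    simp only [evenLow, block_zero, Nat.sub_zero, Nat.reduceMul]
    rw [show 2 * n - 1 = 2 * (n - 3) + 5 by omega, pow_add, pow_mul]
    norm_num
    omega
  -- The head of the list is exposed: it is the first record after the start of the chain, and the
  -- dyadic boundary separates the two.
  rw [List.Ico.eq_cons (by omega), List.map_cons, List.cons_append] at h ⊢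
  exact h.sternRecordSetters_eq (by omega) h0

theorem sternRecordSetters_two_mul_add_one {n : ℕ} (hn : 6 ≤ n) :
    sternRecordSetters (2 * n + 1) =
      [oddLow 0 (n - 2), oddSporadic (n - 4)]
        ++ (List.Ico 1 ((n + 1) / 2 - 1 + 1)).map (fun b => oddLow b (n - 2 - b))
        ++ (List.Ico 0 (n - 2 + 1)).map (fun a => oddHigh a (n - 2 - a))
        ++ [oddLast n] := by
  have hE := three_mul_evenLast (n - 1)
  have hO := three_mul_oddLast n
  have hp := Nat.one_lt_two_pow (n := 2 * n) (by omega)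
  rw [show 2 * (n - 1) + 3 = 2 * n + 1 by omega, pow_add] at hE
  rw [pow_add] at hO
  have hN : 2 ^ (2 * n + 1) = 2 * 2 ^ (2 * n) := pow_succ' _ _
  have h : IsRecordList (2 ^ (2 * n + 1)) (evenLast (n - 1))
      (oddLow 0 (n - 2) :: oddSporadic (n - 4) ::
        ((List.Ico 1 ((n + 1) / 2 - 1 + 1)).map (fun b => oddLow b (n - 2 - b))
        ++ ((List.Ico 0 (n - 2 + 1)).map (fun a => oddHigh a (n - 2 - a))
        ++ [oddLast n]))) := by
    refine IsRecordList.cons ?_ (IsRecordList.cons ?_ (IsRecordList.map_append (by omega) ?_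
      (fun i hi hi' => ?_) (IsRecordList.map_append (Nat.zero_le _) ?_ (fun i _ hi => ?_)
      (IsRecordList.cons ?_ (IsRecordList.nil (by omega) fun i hi => ?_)))))
    · have := isNextRecord_oddLow_zero (n - 3)
      rwa [show n - 3 + 2 = n - 1 by omega, show n - 3 + 1 = n - 2 by omega] at this
    · have := isNextRecord_oddSporadic (n - 6)
      rwa [show n - 6 + 4 = n - 2 by omega, show n - 6 + 2 = n - 4 by omega] at this
    · have := isNextRecord_oddLow_one (n - 6)
      rwa [show n - 6 + 3 = n - 2 - 1 by omega, show n - 6 + 2 = n - 4 by omega] at this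
    · obtain ⟨i, rfl⟩ := Nat.exists_eq_add_of_le' hi
      have := isNextRecord_oddLow_succ (b := i) (c := n - 2 - (i + 2)) (by omega)
      rwa [show n - 2 - (i + 2) + 1 = n - 2 - (i + 1) by omega] at this
    · have := isNextRecord_oddHigh_zero (b := (n + 1) / 2 - 1) (c := n - 2 - ((n + 1) / 2 - 1))
        (by omega) (by omega) (by omega)
      rwa [show (n + 1) / 2 - 1 + (n - 2 - ((n + 1) / 2 - 1)) = n - 2 - 0 by omega] at this
    · have := isNextRecord_oddHigh_succ i (n - 2 - (i + 1))
      rwa [show n - 2 - (i + 1) + 1 = n - 2 - i by omega] at this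
    · have := isNextRecord_oddLast (n - 2)
      rwa [show n - 2 + 2 = n by omega, ← Nat.sub_self (n - 2)] at this
    -- Again the chain ends at the Fibonacci maximum, now F_{2n+2}.
    · refine (stern_le_fib (2 * n + 1) i (by omega)).trans_eq ?_
      rw [stern_oddLast, show 2 * n + 1 + 1 = 2 * (n + 1) by ring, fib_two_mul_eq, fibE_succ]
  have h0 : 2 ^ (2 * n) ≤ oddLow 0 (n - 2) := by
    have := three_mul_block 8 (n - 2)
    simp only [oddLow, block_zero, Nat.reduceMul]
    rw [show 2 * n = 2 * (n - 2) + 4 by omega, pow_add, pow_mul]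
    norm_num
    omega
  have hu : evenLast (n - 1) < 2 ^ (2 * n) := by omega
  rw [h.sternRecordSetters_eq hu h0]
  simp only [List.append_assoc, List.cons_append, List.nil_append]

/-! ### Closed forms -/

theorem evenLow_cast (a c : ℕ) : (evenLow a c : ℚ) =
    2 ^ (2 * (a + c) + 5) + (2 ^ (2 * (a + c) + 4) - 2 ^ (2 * c + 3) + 1) / 3 := by
  rw [evenLow]
  push_cast [block_cast]
  simp only [mul_add, pow_add, pow_mul]
  norm_num
  ring

theorem evenHigh_cast (b c : ℕ) : (evenHigh b c : ℚ) =
    (2 ^ (2 * (b + c) + 3) - 2 ^ (2 * c + 2) - 1) / 3 := by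
  rw [evenHigh]
  push_cast [block_cast]
  simp only [mul_add, pow_add, pow_mul]
  norm_num
  ring

theorem evenLast_cast (c : ℕ) : (evenLast c : ℚ) = (2 ^ (2 * c + 3) + 1) / 3 := by
  rw [evenLast]
  push_cast [block_cast]
  simp only [mul_add, pow_add, pow_mul]
  norm_num
  ring

theorem oddLow_cast (b c : ℕ) : (oddLow b c : ℚ) =
    2 ^ (2 * (b + c) + 4) + (2 ^ (2 * (b + c) + 3) - 2 ^ (2 * c + 2) - 1) / 3 := by
  rw [oddLow]
  push_cast [block_cast]
  simp only [mul_add, pow_add, pow_mul]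
  norm_num
  ring

theorem oddSporadic_cast (c : ℕ) : (oddSporadic c : ℚ) =
    2 ^ (2 * c + 8) + 2 ^ (2 * c + 5) + (2 ^ (2 * c + 4) - 7) / 3 := by
  rw [oddSporadic]
  push_cast [block_cast]
  simp only [mul_add, pow_add, pow_mul]
  norm_num
  ring

theorem oddHigh_cast (a c : ℕ) : (oddHigh a c : ℚ) =
    (2 ^ (2 * (a + c) + 6) - 2 ^ (2 * c + 3) + 1) / 3 := by
  rw [oddHigh]
  push_cast [block_cast]
  simp only [mul_add, pow_add, pow_mul]
  norm_num
  ring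

theorem oddLast_cast (c : ℕ) : (oddLast c : ℚ) = (2 ^ (2 * c + 2) - 1) / 3 := by
  rw [oddLast]
  push_cast [block_cast]
  simp only [mul_add, pow_add, pow_mul]
  norm_num
  ring

theorem fib_two_mul_add_two_eq (j : ℕ) : Nat.fib (2 * j + 2) = fibO j + 2 * fibE j :=
  fibE_succ j

theorem fib_two_mul_add_three_eq (j : ℕ) : Nat.fib (2 * j + 3) = 2 * fibO j + 3 * fibE j := by
  rw [show 2 * j + 3 = 2 * (j + 1) + 1 by ring, fib_two_mul_add_one_eq, fibO_succ, fibE_succ]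
  ring

theorem fib_two_mul_add_four_eq (j : ℕ) : Nat.fib (2 * j + 4) = 3 * fibO j + 5 * fibE j := by
  rw [show 2 * j + 4 = 2 * (j + 1) + 2 by ring, fib_two_mul_add_two_eq, fibO_succ, fibE_succ]
  ring

theorem stern_evenLow_eq (a c : ℕ) : stern (evenLow a c) =
    lucas (2 * a + 3) * Nat.fib (2 * c + 3) + lucas (2 * a + 1) * Nat.fib (2 * c + 2) := by
  rw [stern_evenLow, lucas_two_mul_add_three, lucas_two_mul_add_one, fib_two_mul_add_three_eq,
    fib_two_mul_add_two_eq]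
  ring

theorem stern_evenHigh_eq (b c : ℕ) : stern (evenHigh b c) =
    Nat.fib (2 * b + 2) * Nat.fib (2 * c + 2) + Nat.fib (2 * b) * Nat.fib (2 * c + 1) := by
  rw [stern_evenHigh, fib_two_mul_add_two_eq, fib_two_mul_add_two_eq, fib_two_mul_eq,
    fib_two_mul_add_one_eq]
  ring

theorem stern_evenLast_eq (c : ℕ) : stern (evenLast c) = Nat.fib (2 * c + 3) := by
  rw [stern_evenLast, fib_two_mul_add_three_eq]

theorem stern_oddLow_zero_eq (c : ℕ) :
    stern (oddLow 0 c) = Nat.fib (2 * c + 5) + Nat.fib (2 * c) := by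
  rw [stern_oddLow, show 2 * c + 5 = 2 * (c + 1) + 3 by ring, fib_two_mul_add_three_eq,
    fib_two_mul_eq, fibO_succ, fibE_succ, fibO_zero, fibE_zero]
  ring

theorem stern_oddSporadic_eq (c : ℕ) :
    stern (oddSporadic (c + 2)) = Nat.fib (2 * c + 13) + 8 * Nat.fib (2 * c + 4) := by
  rw [stern_oddSporadic, show 2 * c + 13 = 2 * (c + 5) + 3 by ring, fib_two_mul_add_three_eq,
    fib_two_mul_add_four_eq]
  simp only [fibO_succ, fibE_succ]
  ring

theorem stern_oddLow_eq (b c : ℕ) : stern (oddLow b c) =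
    lucas (2 * b + 3) * Nat.fib (2 * c + 2) + lucas (2 * b + 1) * Nat.fib (2 * c + 1) := by
  rw [stern_oddLow, lucas_two_mul_add_three, lucas_two_mul_add_one, fib_two_mul_add_two_eq,
    fib_two_mul_add_one_eq]
  ring

theorem stern_oddHigh_eq (a c : ℕ) : stern (oddHigh a c) =
    Nat.fib (2 * a + 4) * Nat.fib (2 * c + 3) + Nat.fib (2 * a + 2) * Nat.fib (2 * c + 2) := by
  rw [stern_oddHigh, fib_two_mul_add_four_eq, fib_two_mul_add_three_eq, fib_two_mul_add_two_eq,
    fib_two_mul_add_two_eq]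
  ring

theorem stern_oddLast_eq (c : ℕ) : stern (oddLast c) = Nat.fib (2 * c + 2) := by
  rw [stern_oddLast, fib_two_mul_add_two_eq]

/-- The formulas for the record-setters are evaluated in `ℚ`, so that `/ 3` is exact division and
`-` is not truncated. `List.Ico l u` is the increasing list of all `i` with `l ≤ i < u`;
`(n + 1) / 2` is `⌈n / 2⌉`. All exponents and Fibonacci indices are nonnegative for
the parameters in the indicated ranges. -/
theorem mainTheorem4 (k n : ℕ) (hk : 12 ≤ k) :
    (k = 2 * n →
      (sternRecordSetters k).map (fun v : ℕ => (v : ℚ)) =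
          (List.Ico 0 (n - 3 + 1)).map (fun a : ℕ =>
            (2 : ℚ) ^ (2 * n - 1) + (2 ^ (2 * n - 2) - 2 ^ (2 * n - 2 * a - 3) + 1) / 3)
          ++ (List.Ico 1 (n / 2 + 1)).map (fun b : ℕ =>
            ((2 : ℚ) ^ (2 * n + 1) - 2 ^ (2 * n - 2 * b) - 1) / 3)
          ++ [((2 : ℚ) ^ (2 * n + 1) + 1) / 3]
      ∧ (sternRecordSetters k).map stern =
          (List.Ico 0 (n - 3 + 1)).map (fun a : ℕ =>
            lucas (2 * a + 3) * Nat.fib (2 * n - 2 * a - 3)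
              + lucas (2 * a + 1) * Nat.fib (2 * n - 2 * a - 4))
          ++ (List.Ico 1 (n / 2 + 1)).map (fun b : ℕ =>
            Nat.fib (2 * b + 2) * Nat.fib (2 * n - 2 * b)
              + Nat.fib (2 * b) * Nat.fib (2 * n - 2 * b - 1))
          ++ [Nat.fib (2 * n + 1)])
    ∧ (k = 2 * n + 1 →
      (sternRecordSetters k).map (fun v : ℕ => (v : ℚ)) =
          [(2 : ℚ) ^ (2 * n) + (2 ^ (2 * n - 2) - 1) / 3,
            (2 : ℚ) ^ (2 * n) + 2 ^ (2 * n - 3) + (2 ^ (2 * n - 4) - 7) / 3]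
          ++ (List.Ico 1 ((n + 1) / 2 - 1 + 1)).map (fun b : ℕ =>
            (2 : ℚ) ^ (2 * n) + (2 ^ (2 * n - 1) - 2 ^ (2 * n - 2 * b - 2) - 1) / 3)
          ++ (List.Ico 0 (n - 2 + 1)).map (fun a : ℕ =>
            ((2 : ℚ) ^ (2 * n + 2) - 2 ^ (2 * n - 2 * a - 1) + 1) / 3)
          ++ [((2 : ℚ) ^ (2 * n + 2) - 1) / 3]
      ∧ (sternRecordSetters k).map stern =
          [Nat.fib (2 * n + 1) + Nat.fib (2 * n - 4),
            Nat.fib (2 * n + 1) + 8 * Nat.fib (2 * n - 8)]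
          ++ (List.Ico 1 ((n + 1) / 2 - 1 + 1)).map (fun b : ℕ =>
            lucas (2 * b + 3) * Nat.fib (2 * n - 2 * b - 2)
              + lucas (2 * b + 1) * Nat.fib (2 * n - 2 * b - 3))
          ++ (List.Ico 0 (n - 2 + 1)).map (fun a : ℕ =>
            Nat.fib (2 * a + 4) * Nat.fib (2 * n - 2 * a - 1)
              + Nat.fib (2 * a + 2) * Nat.fib (2 * n - 2 * a - 2))
          ++ [Nat.fib (2 * n + 2)]) := by
  refine ⟨?_, ?_⟩
  · rintro rfl
    rw [sternRecordSetters_two_mul (by omega)]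
    simp only [List.map_append, List.map_map, List.map_cons, List.map_nil]
    refine ⟨?_, ?_⟩
    · congr 2
      · refine List.map_congr_left fun a ha => ?_
        have := List.Ico.mem.1 ha
        obtain ⟨c, rfl⟩ := Nat.exists_eq_add_of_le (show a + 3 ≤ n by omega)
        rw [Function.comp_apply, show a + 3 + c - 3 - a = c by omega,
          evenLow_cast,
          show 2 * (a + 3 + c) - 1 = 2 * (a + c) + 5 by omega,
          show 2 * (a + 3 + c) - 2 = 2 * (a + c) + 4 by omega,
          show 2 * (a + 3 + c) - 2 * a - 3 = 2 * c + 3 by omega]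
      · refine List.map_congr_left fun b hb => ?_
        have := List.Ico.mem.1 hb
        obtain ⟨c, rfl⟩ := Nat.exists_eq_add_of_le (show b + 1 ≤ n by omega)
        rw [Function.comp_apply, show b + 1 + c - 1 - b = c by omega,
          evenHigh_cast,
          show 2 * (b + 1 + c) + 1 = 2 * (b + c) + 3 by omega,
          show 2 * (b + 1 + c) - 2 * b = 2 * c + 2 by omega]
      · rw [evenLast_cast, show 2 * (n - 1) + 3 = 2 * n + 1 by omega]
    · congr 2
      · refine List.map_congr_left fun a ha => ?_
        have := List.Ico.mem.1 ha
        obtain ⟨c, rfl⟩ := Nat.exists_eq_add_of_le (show a + 3 ≤ n by omega)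
        rw [Function.comp_apply, show a + 3 + c - 3 - a = c by omega,
          stern_evenLow_eq,
          show 2 * (a + 3 + c) - 2 * a - 3 = 2 * c + 3 by omega,
          show 2 * (a + 3 + c) - 2 * a - 4 = 2 * c + 2 by omega]
      · refine List.map_congr_left fun b hb => ?_
        have := List.Ico.mem.1 hb
        obtain ⟨c, rfl⟩ := Nat.exists_eq_add_of_le (show b + 1 ≤ n by omega)
        rw [Function.comp_apply, show b + 1 + c - 1 - b = c by omega,
          stern_evenHigh_eq,
          show 2 * (b + 1 + c) - 2 * b = 2 * c + 2 by omega,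
          show 2 * c + 2 - 1 = 2 * c + 1 by omega]
      · rw [stern_evenLast_eq, show 2 * (n - 1) + 3 = 2 * n + 1 by omega]
  · rintro rfl
    rw [sternRecordSetters_two_mul_add_one (by omega)]
    simp only [List.map_append, List.map_map, List.map_cons, List.map_nil]
    refine ⟨?_, ?_⟩
    · refine congrArg₂ (· ++ ·) (congrArg₂ (· ++ ·) (congrArg₂ (· ++ ·) ?_ ?_) ?_) ?_
      · obtain ⟨c, rfl⟩ := Nat.exists_eq_add_of_le (show 6 ≤ n by omega)
        rw [show 6 + c - 2 = c + 4 by omega, show 6 + c - 4 = c + 2 by omega, oddLow_cast,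
          oddSporadic_cast, show 2 * (6 + c) = 2 * c + 12 by omega,
          show 2 * c + 12 - 2 = 2 * c + 10 by omega, show 2 * c + 12 - 3 = 2 * c + 9 by omega,
          show 2 * c + 12 - 4 = 2 * c + 8 by omega]
        simp only [mul_add, pow_add, pow_mul]
        norm_num
        constructor <;> ring
      · refine List.map_congr_left fun b hb => ?_
        have := List.Ico.mem.1 hb
        obtain ⟨c, rfl⟩ := Nat.exists_eq_add_of_le (show b + 2 ≤ n by omega)
        rw [Function.comp_apply, show b + 2 + c - 2 - b = c by omega,
          oddLow_cast,
          show 2 * (b + 2 + c) - 1 = 2 * (b + c) + 3 by omega,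
          show 2 * (b + 2 + c) - 2 * b - 2 = 2 * c + 2 by omega,
          show 2 * (b + 2 + c) = 2 * (b + c) + 4 by omega]
      · refine List.map_congr_left fun a ha => ?_
        have := List.Ico.mem.1 ha
        obtain ⟨c, rfl⟩ := Nat.exists_eq_add_of_le (show a + 2 ≤ n by omega)
        rw [Function.comp_apply, show a + 2 + c - 2 - a = c by omega,
          oddHigh_cast,
          show 2 * (a + 2 + c) + 2 = 2 * (a + c) + 6 by omega,
          show 2 * (a + 2 + c) - 2 * a - 1 = 2 * c + 3 by omega]
      · rw [oddLast_cast]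
    · refine congrArg₂ (· ++ ·) (congrArg₂ (· ++ ·) (congrArg₂ (· ++ ·) ?_ ?_) ?_) ?_
      · obtain ⟨c, rfl⟩ := Nat.exists_eq_add_of_le (show 6 ≤ n by omega)
        rw [show 6 + c - 2 = c + 4 by omega, show 6 + c - 4 = c + 2 by omega,
          stern_oddLow_zero_eq, stern_oddSporadic_eq, show 2 * (6 + c) = 2 * c + 12 by omega]
        rfl
      · refine List.map_congr_left fun b hb => ?_
        have := List.Ico.mem.1 hb
        obtain ⟨c, rfl⟩ := Nat.exists_eq_add_of_le (show b + 2 ≤ n by omega)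
        rw [Function.comp_apply, show b + 2 + c - 2 - b = c by omega,
          stern_oddLow_eq,
          show 2 * (b + 2 + c) - 2 * b - 2 = 2 * c + 2 by omega,
          show 2 * (b + 2 + c) - 2 * b - 3 = 2 * c + 1 by omega]
      · refine List.map_congr_left fun a ha => ?_
        have := List.Ico.mem.1 ha
        obtain ⟨c, rfl⟩ := Nat.exists_eq_add_of_le (show a + 2 ≤ n by omega)
        rw [Function.comp_apply, show a + 2 + c - 2 - a = c by omega,
          stern_oddHigh_eq,
          show 2 * (a + 2 + c) - 2 * a - 1 = 2 * c + 3 by omega,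
          show 2 * (a + 2 + c) - 2 * a - 2 = 2 * c + 2 by omega]
      · rw [stern_oddLast_eq]
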